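/- Let $k$ be a commutative ring (for instance a field) and let $A$ be a Hopf algebra over $k$, with comultiplication $\Delta$, counit $\epsilon$ and antipode $s$, that is finitely generated and projective as a $k$-module (when $k$ is a field: finite-dimensional). Assume that: (a) $A$ is unimodular: an element $t\in A$ satisfies $xt=\epsilon(x)t$ for all $x\in A$ if and only if it satisfies $tx=\epsilon(x)t$ for all $x\in A$. (b) $A$ is quasitriangular: there is given an invertible element $\rho=\sum e\otimes e'\in A\otimes A$ such that $\rho\,\Delta(x)=\Delta'(x)\,\rho$ for all $x\in A$, where $\Delta'$ is $\Delta$ followed by the interchange of the two tensor factors, and $(1_A\otimes\Delta)\rho=\rho_{13}\rho_{12}$ and $(\Delta\otimes 1_A)\rho=\rho_{13}\rho_{23}$ in $A\otimes A\otimes A$, where $\rho_{12}=\sum e\otimes e'\otimes 1$, $\rho_{13}=\sum e\otimes 1\otimes e'$ and $\rho_{23}=\sum 1\otimes e\otimes e'$. (c) $A$ is ribbon with special grouplike element $G$: $G\in A$ satisfies $\Delta(G)=G\otimes G$ and $\epsilon(G)=1$ (so that $G$ is invertible), and, with $u=\sum s(e')e$, the element $v=G^{-1}u$ is central in $A$ and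 $s(u)=G^{-1}uG^{-1}$. Let $\lambda\colon A\to k$ be any right integral, that is, a $k$-linear functional with $\lambda(x)1=\sum\lambda(x_1)x_2$ for all $x\in A$, where $\Delta(x)=\sum x_1\otimes x_2$. Define $\mathrm{tr}\colon A\to k$ by $\mathrm{tr}(x)=\lambda(Gx)$. Then $$\mathrm{tr}(xy)=\mathrm{tr}(yx)\quad\text{for all }x,y\in A,\qquad\text{and}\qquad \mathrm{tr}(s(x))=\mathrm{tr}(x)\quad\text{for all }x\in A.$$ -/

import Mathlib

open scoped TensorProduct

namespace RibbonHopf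

variable {k A : Type*} [CommRing k] [Ring A] [HopfAlgebra k A]

/-- For `ρ = ∑ e ⊗ e'`, the element `ρ₁₂ = ∑ e ⊗ e' ⊗ 1` of `A ⊗ A ⊗ A`. -/
noncomputable def leg12 (ρ : A ⊗[k] A) : A ⊗[k] (A ⊗[k] A) :=
  Algebra.TensorProduct.map (AlgHom.id k A) Algebra.TensorProduct.includeLeft ρ

/-- For `ρ = ∑ e ⊗ e'`, the element `ρ₁₃ = ∑ e ⊗ 1 ⊗ e'` of `A ⊗ A ⊗ A`. -/
noncomputable def leg13 (ρ : A ⊗[k] A) : A ⊗[k] (A ⊗[k] A) :=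
  Algebra.TensorProduct.map (AlgHom.id k A) Algebra.TensorProduct.includeRight ρ

/-- For `ρ = ∑ e ⊗ e'`, the element `ρ₂₃ = ∑ 1 ⊗ e ⊗ e'` of `A ⊗ A ⊗ A`. -/
noncomputable def leg23 (ρ : A ⊗[k] A) : A ⊗[k] (A ⊗[k] A) :=
  Algebra.TensorProduct.includeRight ρ

/-- `ρ` is a quasitriangular structure (universal R-matrix) on the Hopf algebra `A`. -/
structure IsQuasitriangular (ρ : A ⊗[k] A) : Prop where
  /-- `ρ` is invertible in the algebra `A ⊗ A`. -/
  isUnit : IsUnit ρ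
  /-- `ρ Δ(x) = Δ'(x) ρ`, where `Δ'` is the opposite comultiplication. -/
  mul_comul (x : A) :
    ρ * Coalgebra.comul (R := k) x =
      TensorProduct.comm k A A (Coalgebra.comul (R := k) x) * ρ
  /-- `(1 ⊗ Δ) ρ = ρ₁₃ ρ₁₂`. -/
  lTensor_comul : (Coalgebra.comul (R := k) (A := A)).lTensor A ρ = leg13 ρ * leg12 ρ
  /-- `(Δ ⊗ 1) ρ = ρ₁₃ ρ₂₃`. -/
  rTensor_comul :
    TensorProduct.assoc k A A A ((Coalgebra.comul (R := k) (A := A)).rTensor A ρ) =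
      leg13 ρ * leg23 ρ

/-- The Drinfeld element `u = ∑ s(e') e` of `ρ = ∑ e ⊗ e'`. -/
noncomputable def drinfeldElement (ρ : A ⊗[k] A) : A :=
  LinearMap.mul' k A
    (TensorProduct.comm k A A ((HopfAlgebra.antipode k (A := A)).lTensor A ρ))

/-- The grouplike element `G` is a special grouplike element of the quasitriangular Hopf algebra
`(A, ρ)`: with `u` the Drinfeld element, `v = G⁻¹ u` is central and `s(u) = G⁻¹ u G⁻¹`. -/
structure IsSpecialGrouplike (ρ : A ⊗[k] A) (G : GroupLike k A) : Prop where
  mem_center : (G⁻¹).val * drinfeldElement ρ ∈ Set.center A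
  antipode_drinfeldElement :
    HopfAlgebra.antipode k (drinfeldElement ρ) = (G⁻¹).val * drinfeldElement ρ * (G⁻¹).val

variable (k A) in
/-- The Hopf algebra `A` is unimodular: its left integrals (elements `t` with `x t = ε(x) t` for
all `x`) and its right integrals (elements `t` with `t x = ε(x) t` for all `x`) coincide. -/
def IsUnimodular : Prop :=
  ∀ t : A, (∀ x : A, x * t = Coalgebra.counit (R := k) x • t) ↔
    (∀ x : A, t * x = Coalgebra.counit (R := k) x • t)

/-- The functional `l` in the dual algebra is a right integral: `l(x) 1 = ∑ l(x₁) x₂`. -/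
def IsRightIntegral (l : Module.Dual k A) : Prop :=
  ∀ x : A, TensorProduct.lid k A (l.rTensor A (Coalgebra.comul (R := k) x)) =
    algebraMap k A (l x)

/-- The functional `tr(x) = l(G x)`. -/
noncomputable def tr (l : Module.Dual k A) (G : GroupLike k A) : Module.Dual k A :=
  l ∘ₗ LinearMap.mulLeft k G.val

end RibbonHopf

/-! Write `S` for the antipode. Both identities follow from `S²(x) = G x G⁻¹` and two facts on right
integrals `l`: `l(xy) = l(S²(y)x)` and `l(S(x)) = l(G²x)`. Indeed `l(Gxy) = l(S²(y)Gx) = l(Gyx)`,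
and `tr(S(x)) = l(S(xG⁻¹)) = l(G²xG⁻¹) = tr(GxG⁻¹) = tr(x)`.

The formula for `S²` holds because conjugation by the Drinfeld element `u` is `S²` and `G⁻¹u` is
central. For the two facts, let `f` be the difference of the two functionals and `t` a two-sided
integral. Then `m(S(t)) f(S(x)) = m(S(x · ∑ f(t₁)t₂))` for every right integral `m`
(`IsRightIntegral.apply_antipode_mul_apply`), so it is enough to compute `∑ f(t₁)t₂`. For the first
fact it vanishes by unimodularity. For the second, slicing `ρΔ(t) = Δ'(t)ρ` by `l` brings in `G²`.

Over a ring no single pair of integrals need satisfy `m(S(t)) = 1`. Instead the values `m(S(t))`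
generate the unit ideal (`span_integral_apply_antipode_eq_top`): the trace of `P ∘ S` is `1` for an
explicit projection `P` (`integralProj`) onto the integrals, and this trace is a sum of such values.
-/

namespace RibbonHopf

open Coalgebra HopfAlgebra TensorProduct

/-! ### Sweedler calculus. -/

section Sweedler

variable {k A M : Type*} [CommRing k] [Ring A] [HopfAlgebra k A] [AddCommGroup M] [Module k M]

/-- Coassociativity in Sweedler form, for a trilinear function. -/
theorem sum_sum_repr_assoc (F : A → A → A → M)
    (h₁ : ∀ b c, IsLinearMap k (F · b c)) (h₂ : ∀ a c, IsLinearMap k (F a · c))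
    (h₃ : ∀ a b, IsLinearMap k (F a b)) (x : A) :
    ∑ i ∈ (ℛ k x).index, ∑ j ∈ (ℛ k ((ℛ k x).left i)).index,
        F ((ℛ k ((ℛ k x).left i)).left j) ((ℛ k ((ℛ k x).left i)).right j) ((ℛ k x).right i) =
      ∑ i ∈ (ℛ k x).index, ∑ j ∈ (ℛ k ((ℛ k x).right i)).index,
        F ((ℛ k x).left i) ((ℛ k ((ℛ k x).right i)).left j)
          ((ℛ k ((ℛ k x).right i)).right j) := by
  let T : A ⊗[k] (A ⊗[k] A) →ₗ[k] M :=
    lift (lift.equiv (.id k) A A M ∘ₗ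
      { toFun := fun a => LinearMap.mk₂ k (F a) (fun b b' c => (h₂ a c).map_add b b')
          (fun t b c => (h₂ a c).map_smul t b) (fun b => (h₃ a b).map_add)
          (fun t b c => (h₃ a b).map_smul t c)
        map_add' := fun a a' => by ext b c; exact (h₁ b c).map_add a a'
        map_smul' := fun t a => by ext b c; exact (h₁ b c).map_smul t a } : A →ₗ[k] _)
  have hT (a b c : A) : T (a ⊗ₜ (b ⊗ₜ c)) = F a b c := rfl
  simpa only [map_sum, hT] using congr(T $(sum_tmul_tmul_eq (ℛ k x)
    (fun i => ℛ k ((ℛ k x).left i)) (fun i => ℛ k ((ℛ k x).right i))))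

theorem sum_counit_smul_right (x : A) :
    ∑ i ∈ (ℛ k x).index, counit (R := k) ((ℛ k x).right i) • (ℛ k x).left i = x := by
  have h := congr(TensorProduct.rid k A $(sum_tmul_counit_eq (ℛ k x)))
  simpa only [map_sum, TensorProduct.rid_tmul, one_smul] using h

theorem sum_mul_comul_repr (w : A ⊗[k] A) (x : A) :
    ∑ j ∈ (ℛ k x).index, w * ((ℛ k x).left j ⊗ₜ (ℛ k x).right j) = w * comul x := by
  rw [← Finset.mul_sum, (ℛ k x).eq]

end Sweedler

/-! ### The antipode and the comultiplication. -/

section Antipode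

variable {k A : Type*} [CommRing k] [Ring A] [HopfAlgebra k A]

/-- `∑ (S(x₁) ⊗ 1) Δ(x₂) = 1 ⊗ x`. -/
theorem sum_antipode_left_mul_comul (x : A) :
    ∑ i ∈ (ℛ k x).index, (antipode k ((ℛ k x).left i) ⊗ₜ (1 : A)) * comul ((ℛ k x).right i) =
      (1 : A) ⊗ₜ[k] x := by
  have h := sum_sum_repr_assoc (k := k)
    (fun a b c : A => (antipode k a ⊗ₜ[k] (1 : A)) * (b ⊗ₜ[k] c))
    (fun b c => ⟨by simp [add_tmul, add_mul], by simp [← smul_tmul']⟩)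
    (fun a c => ⟨by simp [add_tmul, mul_add], by simp [← smul_tmul']⟩)
    (fun a b => ⟨by simp [tmul_add, mul_add], by simp⟩) x
  simp only [sum_mul_comul_repr] at h
  rw [← h]
  simp only [Algebra.TensorProduct.tmul_mul_tmul, one_mul, ← sum_tmul,
    sum_antipode_mul_eq_smul]
  simp only [smul_tmul, ← tmul_sum, sum_counit_smul]

/-- `∑ Δ(x₁) (1 ⊗ S(x₂)) = x ⊗ 1`. -/
theorem sum_comul_mul_antipode_right (x : A) :
    ∑ i ∈ (ℛ k x).index, comul ((ℛ k x).left i) * ((1 : A) ⊗ₜ antipode k ((ℛ k x).right i)) =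
      x ⊗ₜ[k] (1 : A) := by
  have h := sum_sum_repr_assoc (k := k)
    (fun a b c : A => (a ⊗ₜ[k] b) * ((1 : A) ⊗ₜ[k] antipode k c))
    (fun b c => ⟨by simp [add_tmul, add_mul], by simp [← smul_tmul']⟩)
    (fun a c => ⟨by simp [tmul_add, add_mul], by simp⟩)
    (fun a b => ⟨by simp [tmul_add, mul_add], by simp⟩) x
  simp only [← Finset.sum_mul, (ℛ k _).eq] at h
  rw [h]
  simp only [Algebra.TensorProduct.tmul_mul_tmul, mul_one, ← tmul_sum,
    sum_mul_antipode_eq_smul]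
  simp only [← smul_tmul, ← sum_tmul, sum_counit_smul_right]

/-- `∑ (1 ⊗ x₁) Δ(S(x₂)) = S(x) ⊗ 1`. -/
theorem sum_right_mul_comul_antipode (x : A) :
    ∑ i ∈ (ℛ k x).index, ((1 : A) ⊗ₜ[k] (ℛ k x).left i) * comul (antipode k ((ℛ k x).right i)) =
      antipode k x ⊗ₜ[k] (1 : A) := by
  have h := sum_sum_repr_assoc (k := k)
    (fun a b c : A => (antipode k a ⊗ₜ[k] (1 : A)) * comul b * comul (antipode k c))
    (fun b c => ⟨by simp [add_tmul, add_mul], by simp [← smul_tmul']⟩)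
    (fun a c => ⟨by simp [add_mul, mul_add], by simp⟩)
    (fun a b => ⟨by simp [mul_add], by simp⟩) x
  simp only [← Finset.sum_mul, sum_antipode_left_mul_comul] at h
  rw [h]
  simp only [mul_assoc, ← Finset.mul_sum, ← Bialgebra.comul_mul, ← map_sum,
    sum_mul_antipode_eq_smul]
  simp only [map_smul, Bialgebra.comul_one, mul_smul_comm, mul_one]
  simp only [smul_tmul', ← sum_tmul, ← map_smul, ← map_sum, sum_counit_smul_right]

/-- `Δ(S(x)) = ∑ S(x₂) ⊗ S(x₁)`. -/
theorem comul_antipode (x : A) :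
    comul (antipode k x) =
      ∑ i ∈ (ℛ k x).index, antipode k ((ℛ k x).right i) ⊗ₜ[k] antipode k ((ℛ k x).left i) := by
  -- `∑ (1 ⊗ S(x₁)x₂) Δ(S(x₃))` is evaluated twice: cancelling `S(x₁)x₂` leaves `Δ(S(x))`,
  -- cancelling the last two factors leaves the right side.
  have h := sum_sum_repr_assoc (k := k)
    (fun a b c : A => ((1 : A) ⊗ₜ[k] antipode k a) * (((1 : A) ⊗ₜ[k] b) * comul (antipode k c)))
    (fun b c => ⟨by simp [tmul_add, add_mul], by simp⟩)
    (fun a c => ⟨by simp [tmul_add, add_mul, mul_add], by simp⟩)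
    (fun a b => ⟨by simp [mul_add], by simp⟩) x
  simp only [← Finset.mul_sum, sum_right_mul_comul_antipode,
    Algebra.TensorProduct.tmul_mul_tmul, one_mul, mul_one] at h
  rw [← h]
  simp only [← mul_assoc, ← Finset.sum_mul, Algebra.TensorProduct.tmul_mul_tmul, one_mul,
    ← tmul_sum, sum_antipode_mul_eq_smul]
  simp only [tmul_smul, smul_mul_assoc, ← Algebra.TensorProduct.one_def, one_mul]
  simp only [← map_smul, ← map_sum, sum_counit_smul]

/-- `∑ (1 ⊗ S(x₂)) Δ(S²(x₁)) = S²(x) ⊗ 1`. -/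
theorem sum_antipode_right_mul_comul (x : A) :
    ∑ i ∈ (ℛ k x).index, ((1 : A) ⊗ₜ[k] antipode k ((ℛ k x).right i)) *
        comul (antipode k (antipode k ((ℛ k x).left i))) =
      antipode k (antipode k x) ⊗ₜ[k] (1 : A) := by
  rw [← sum_right_mul_comul_antipode (antipode k x)]
  let T : A ⊗[k] A →ₗ[k] A ⊗[k] A := LinearMap.mul' k _ ∘ₗ
    TensorProduct.map (TensorProduct.mk k A A 1) (comul ∘ₗ antipode k)
  have hT (a b : A) : T (a ⊗ₜ b) = (1 ⊗ₜ a) * comul (antipode k b) := by simp [T]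
  calc _ = T (comul (antipode k x)) := by simp only [comul_antipode, map_sum, hT]
    _ = _ := by rw [← (ℛ k (antipode k x)).eq]; simp only [map_sum, hT]

end Antipode

/-! ### The R-matrix, the Drinfeld element and the square of the antipode. -/

section RMatrix

variable {k A : Type*} [CommRing k] [Ring A] [HopfAlgebra k A] {ρ : A ⊗[k] A}

variable (k A) in
/-- The algebra map `ε ⊗ id`. -/
noncomputable def counitLeft (B : Type*) [Ring B] [Algebra k B] : A ⊗[k] B →ₐ[k] B :=
  (Algebra.TensorProduct.lid k B : k ⊗[k] B →ₐ[k] B).comp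
    (Algebra.TensorProduct.map (Bialgebra.counitAlgHom k A) (AlgHom.id k B))

variable (k A) in
/-- The algebra map `id ⊗ ε`. -/
noncomputable def counitRight (B : Type*) [Ring B] [Algebra k B] : B ⊗[k] A →ₐ[k] B :=
  (Algebra.TensorProduct.rid k k B : B ⊗[k] k →ₐ[k] B).comp
    (Algebra.TensorProduct.map (AlgHom.id k B) (Bialgebra.counitAlgHom k A))

@[simp] theorem counitLeft_tmul {B : Type*} [Ring B] [Algebra k B] (a : A) (b : B) :
    counitLeft k A B (a ⊗ₜ b) = counit (R := k) a • b := by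
  simp [counitLeft]

@[simp] theorem counitRight_tmul {B : Type*} [Ring B] [Algebra k B] (a : A) (b : B) :
    counitRight k A B (b ⊗ₜ a) = counit (R := k) a • b := by
  simp [counitRight]

@[simp] theorem leg12_tmul (a b : A) : leg12 (a ⊗ₜ[k] b) = a ⊗ₜ (b ⊗ₜ 1) := rfl
@[simp] theorem leg13_tmul (a b : A) : leg13 (a ⊗ₜ[k] b) = a ⊗ₜ (1 ⊗ₜ b) := rfl
@[simp] theorem leg23_tmul (a b : A) : leg23 (a ⊗ₜ[k] b) = 1 ⊗ₜ (a ⊗ₜ b) := rfl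
@[simp] theorem leg12_add (w z : A ⊗[k] A) : leg12 (w + z) = leg12 w + leg12 z := map_add _ w z
@[simp] theorem leg13_add (w z : A ⊗[k] A) : leg13 (w + z) = leg13 w + leg13 z := map_add _ w z
@[simp] theorem leg23_add (w z : A ⊗[k] A) : leg23 (w + z) = leg23 w + leg23 z := map_add _ w z
@[simp] theorem leg12_zero : leg12 (0 : A ⊗[k] A) = 0 := map_zero _
@[simp] theorem leg13_zero : leg13 (0 : A ⊗[k] A) = 0 := map_zero _
@[simp] theorem leg23_zero : leg23 (0 : A ⊗[k] A) = 0 := map_zero _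

/-- Applying `ε` to the first leg of `(Δ ⊗ 1)ρ = ρ₁₃ρ₂₃` gives `ρ = (1 ⊗ (ε ⊗ id)ρ) ρ`, and `ρ`
cancels. -/
theorem IsQuasitriangular.counitLeft_eq_one (hρ : IsQuasitriangular ρ) :
    counitLeft k A A ρ = 1 := by
  have h := congr(counitLeft k A (A ⊗[k] A) $hρ.rTensor_comul)
  have h₁ (w : A ⊗[k] A) : counitLeft k A (A ⊗[k] A)
      (TensorProduct.assoc k A A A ((comul (R := k) (A := A)).rTensor A w)) = w := by
    induction w with
    | zero => simp
    | add x y hx hy => simp [hx, hy]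
    | tmul a b =>
      rw [LinearMap.rTensor_tmul, ← (ℛ k a).eq]
      simp only [sum_tmul, map_sum, TensorProduct.assoc_tmul, counitLeft_tmul]
      simp only [smul_tmul', ← sum_tmul, sum_counit_smul]
  have h₂ (w : A ⊗[k] A) : counitLeft k A (A ⊗[k] A) (leg13 w) = 1 ⊗ₜ counitLeft k A A w := by
    induction w with
    | zero => simp
    | add x y hx hy => simp [hx, hy, tmul_add]
    | tmul a b => simp
  have h₃ (w : A ⊗[k] A) : counitLeft k A (A ⊗[k] A) (leg23 w) = w := by
    induction w with
    | zero => simp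
    | add x y hx hy => simp [hx, hy]
    | tmul a b => simp
  rw [h₁, map_mul, h₂, h₃] at h
  have h' := hρ.isUnit.mul_right_cancel ((one_mul ρ).trans h)
  simpa [Algebra.TensorProduct.one_def] using congr(counitLeft k A A $h').symm

theorem IsQuasitriangular.counitRight_eq_one (hρ : IsQuasitriangular ρ) :
    counitRight k A A ρ = 1 := by
  let T : A ⊗[k] (A ⊗[k] A) →ₐ[k] A ⊗[k] A :=
    Algebra.TensorProduct.map (AlgHom.id k A) (counitLeft k A A)
  have h := congr(T $hρ.lTensor_comul)
  have h₁ (w : A ⊗[k] A) : T ((comul (R := k) (A := A)).lTensor A w) = w := by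
    induction w with
    | zero => simp
    | add x y hx hy => simp only [map_add, hx, hy]
    | tmul a b =>
      rw [LinearMap.lTensor_tmul, ← (ℛ k b).eq]
      simp [T, sum_counit_smul]
  have h₂ (w : A ⊗[k] A) : T (leg13 w) = w := by
    induction w with
    | zero => simp
    | add x y hx hy => simp [hx, hy]
    | tmul a b => simp [T]
  have h₃ (w : A ⊗[k] A) : T (leg12 w) = counitRight k A A w ⊗ₜ 1 := by
    induction w with
    | zero => simp
    | add x y hx hy => simp [hx, hy, add_tmul]
    | tmul a b => simp [T, smul_tmul']
  rw [h₁, map_mul, h₂, h₃] at h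
  have h' := hρ.isUnit.mul_left_cancel ((mul_one ρ).trans h)
  simpa [Algebra.TensorProduct.one_def] using congr(counitRight k A A $h').symm

/-- `(S ⊗ id) ρ` is a left inverse of `ρ`. -/
theorem IsQuasitriangular.rTensor_antipode_mul (hρ : IsQuasitriangular ρ) :
    (antipode k).rTensor A ρ * ρ = 1 := by
  let T : A ⊗[k] (A ⊗[k] A) →ₗ[k] A ⊗[k] A :=
    (LinearMap.mul' k A ∘ₗ (antipode k).rTensor A).rTensor A ∘ₗ
      (TensorProduct.assoc k A A A).symm.toLinearMap
  have hT (a b c : A) : T (a ⊗ₜ (b ⊗ₜ c)) = (antipode k a * b) ⊗ₜ c := rfl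
  have h := congr(T $hρ.rTensor_comul)
  have h₁ (w : A ⊗[k] A) :
      T (TensorProduct.assoc k A A A ((comul (R := k) (A := A)).rTensor A w)) =
        1 ⊗ₜ counitLeft k A A w := by
    induction w with
    | zero => simp
    | add x y hx hy => simp only [map_add, hx, hy, tmul_add]
    | tmul a b =>
      rw [LinearMap.rTensor_tmul, ← (ℛ k a).eq]
      simp only [sum_tmul, map_sum, TensorProduct.assoc_tmul, counitLeft_tmul, hT]
      simp only [← sum_tmul, sum_antipode_mul_eq_smul, smul_tmul]
  have h₂ (w z : A ⊗[k] A) : T (leg13 w * leg23 z) = (antipode k).rTensor A w * z := by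
    induction w with
    | zero => simp
    | add x y hx hy => simp [add_mul, hx, hy]
    | tmul a b =>
      induction z with
      | zero => simp
      | add x y hx hy => simp only [leg23_add, mul_add, map_add, hx, hy]
      | tmul c d => simp [hT]
  rw [h₁, h₂, hρ.counitLeft_eq_one] at h
  exact h.symm

theorem IsQuasitriangular.mul_rTensor_antipode (hρ : IsQuasitriangular ρ) :
    ρ * (antipode k).rTensor A ρ = 1 := by
  obtain ⟨r, rfl⟩ := hρ.isUnit
  rw [left_inv_eq_right_inv hρ.rTensor_antipode_mul r.mul_inv, r.mul_inv]

/-- `(S ⊗ S) ρ = ρ`. -/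
theorem IsQuasitriangular.map_antipode_antipode (hρ : IsQuasitriangular ρ) :
    TensorProduct.map (antipode k) (antipode k) ρ = ρ := by
  set τ := (antipode k).rTensor A ρ with hτ
  let Γ : A ⊗[k] A →ₐ[k] A ⊗[k] (A ⊗[k] A) :=
    Algebra.TensorProduct.map (AlgHom.id k A) (Bialgebra.comulAlgHom k A)
  have hΓ (w : A ⊗[k] A) : Γ w = (comul (R := k) (A := A)).lTensor A w := rfl
  let T : A ⊗[k] (A ⊗[k] A) →ₗ[k] A ⊗[k] A :=
    (LinearMap.mul' k A ∘ₗ (antipode k).lTensor A).lTensor A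
  have hT (a b c : A) : T (a ⊗ₜ (b ⊗ₜ c)) = a ⊗ₜ (b * antipode k c) := rfl
  -- Here `τ = ρ⁻¹`, so inverting `(1 ⊗ Δ)ρ = ρ₁₃ρ₁₂` reverses the factors. Contracting the last two
  -- legs with `b ⊗ c ↦ b S(c)` then makes `(id ⊗ S)τ` a right inverse of `τ`, hence equal to `ρ`.
  have h₁ : Γ τ = leg12 τ * leg13 τ := by
    refine left_inv_eq_right_inv (a := Γ ρ) ?_ ?_
    · rw [← map_mul, hρ.rTensor_antipode_mul, map_one]
    · have e₁ : leg12 ρ * leg12 τ = 1 := by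
        simp only [leg12, ← map_mul, hτ, hρ.mul_rTensor_antipode, map_one]
      have e₂ : leg13 ρ * leg13 τ = 1 := by
        simp only [leg13, ← map_mul, hτ, hρ.mul_rTensor_antipode, map_one]
      rw [hΓ, hρ.lTensor_comul, mul_assoc, ← mul_assoc (leg12 ρ), e₁, one_mul, e₂]
  have h₂ (w : A ⊗[k] A) : T (Γ w) = counitRight k A A w ⊗ₜ 1 := by
    induction w with
    | zero => simp
    | add x y hx hy => simp only [map_add, hx, hy, add_tmul]
    | tmul a b =>
      rw [hΓ, LinearMap.lTensor_tmul, ← (ℛ k b).eq]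
      simp only [tmul_sum, map_sum, counitRight_tmul, hT]
      simp only [← tmul_sum, sum_mul_antipode_eq_smul, smul_tmul]
  have h₃ (w z : A ⊗[k] A) : T (leg12 w * leg13 z) = w * (antipode k).lTensor A z := by
    induction w with
    | zero => simp
    | add x y hx hy => simp [add_mul, hx, hy]
    | tmul a b =>
      induction z with
      | zero => simp
      | add x y hx hy => simp only [leg13_add, mul_add, map_add, hx, hy]
      | tmul c d => simp [hT]
  have h₄ : counitRight k A A τ = 1 := by
    have := congr(counitRight k A A $hρ.rTensor_antipode_mul)
    rwa [map_mul, hρ.counitRight_eq_one, mul_one, map_one] at this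
  have h₅ : τ * (antipode k).lTensor A τ = 1 := by
    rw [← h₃, ← h₁, h₂, h₄, Algebra.TensorProduct.one_def]
  have h₆ := left_inv_eq_right_inv hρ.mul_rTensor_antipode h₅
  rw [← LinearMap.lTensor_comp_rTensor, LinearMap.comp_apply, ← hτ]
  exact h₆.symm

variable (k A) in
/-- The linear map `a ⊗ b ↦ S(b) a`. -/
noncomputable def antipodeMul : A ⊗[k] A →ₗ[k] A :=
  LinearMap.mul' k A ∘ₗ (TensorProduct.comm k A A).toLinearMap ∘ₗ (antipode k).lTensor A

@[simp] theorem antipodeMul_tmul (a b : A) : antipodeMul k A (a ⊗ₜ b) = antipode k b * a := rfl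

theorem drinfeldElement_eq (ρ : A ⊗[k] A) : drinfeldElement ρ = antipodeMul k A ρ := rfl

theorem antipodeMul_mul_tmul (w : A ⊗[k] A) (p q : A) :
    antipodeMul k A (w * (p ⊗ₜ q)) = antipode k q * antipodeMul k A w * p := by
  induction w with
  | zero => simp
  | add x y hx hy => simp only [add_mul, mul_add, map_add, hx, hy]
  | tmul a b => simp [antipode_mul_antidistrib, mul_assoc]

theorem antipodeMul_comm_comul_mul (w : A ⊗[k] A) (x : A) :
    antipodeMul k A (TensorProduct.comm k A A (comul x) * w) =
      counit (R := k) x • antipodeMul k A w := by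
  induction w with
  | zero => simp
  | add y z hy hz => simp only [mul_add, map_add, hy, hz, smul_add]
  | tmul a b =>
    rw [← (ℛ k x).eq]
    simp only [map_sum, TensorProduct.comm_tmul, Finset.sum_mul,
      Algebra.TensorProduct.tmul_mul_tmul, antipodeMul_tmul, antipode_mul_antidistrib]
    simp only [mul_assoc]
    simp only [← Finset.mul_sum]
    simp only [← mul_assoc (antipode k ((ℛ k x).left _)), ← Finset.sum_mul,
      sum_antipode_mul_eq_smul, smul_mul_assoc, one_mul, mul_smul_comm]

theorem antipode_drinfeldElement (hρ : IsQuasitriangular ρ) :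
    antipode k (drinfeldElement ρ) = LinearMap.mul' k A ((antipode k).lTensor A ρ) := by
  have h (w : A ⊗[k] A) : antipode k (antipodeMul k A w) =
      LinearMap.mul' k A ((antipode k).lTensor A (map (antipode k) (antipode k) w)) := by
    induction w with
    | zero => simp
    | add y z hy hz => simp only [map_add, hy, hz]
    | tmul a b => simp [antipode_mul_antidistrib]
  rw [drinfeldElement_eq, h, hρ.map_antipode_antipode]

/-- This is `ρΔ(x) = Δ'(x)ρ` under `a ⊗ b ↦ S(b)a`; on the right side `S(x₁)x₂` cancels. -/
theorem sum_antipode_mul_drinfeldElement_mul (hρ : IsQuasitriangular ρ) (x : A) :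
    ∑ i ∈ (ℛ k x).index, antipode k ((ℛ k x).right i) * drinfeldElement ρ * (ℛ k x).left i =
      counit (R := k) x • drinfeldElement ρ := by
  simp only [drinfeldElement_eq]
  rw [← antipodeMul_comm_comul_mul, ← hρ.mul_comul, ← (ℛ k x).eq]
  simp only [Finset.mul_sum, map_sum, antipodeMul_mul_tmul]

/-- `S²(x) u = u x`. -/
theorem antipode_antipode_mul_drinfeldElement (hρ : IsQuasitriangular ρ) (x : A) :
    antipode k (antipode k x) * drinfeldElement ρ = drinfeldElement ρ * x := by
  -- In `∑ S²(x₃) S(x₂) u x₁`, collapsing `S(x₂) u x₁` gives `S²(x)u`, while collapsing `S²(x₃)S(x₂)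
  -- = S(x₂S(x₃))` gives `ux`.
  have h := sum_sum_repr_assoc (k := k)
    (fun a b c : A => antipode k (antipode k c) * (antipode k b * drinfeldElement ρ * a))
    (fun b c => ⟨by simp [mul_add], by simp⟩)
    (fun a c => ⟨by simp [add_mul, mul_add], by simp⟩)
    (fun a b => ⟨by simp [add_mul], by simp⟩) x
  simp only [← Finset.mul_sum, sum_antipode_mul_drinfeldElement_mul hρ, mul_smul_comm] at h
  simp only [← smul_mul_assoc, ← Finset.sum_mul, ← map_smul, ← map_sum, sum_counit_smul] at h
  rw [h]
  simp only [← mul_assoc, ← antipode_mul_antidistrib, ← Finset.sum_mul, ← map_sum,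
    sum_mul_antipode_eq_smul, map_smul, antipode_one, smul_mul_assoc, one_mul]
  simp only [← mul_smul_comm, ← Finset.mul_sum, sum_counit_smul_right]

/-- The right inverse is `∑ e' S²(e)`: moving `u` past `e'` gives `∑ S²(e') u S²(e) = ∑ S(e') u
S(e)`, the image of `ρ · (S ⊗ id)ρ = 1` under `a ⊗ b ↦ S(b)a`. -/
theorem exists_drinfeldElement_mul_eq_one (hρ : IsQuasitriangular ρ) :
    ∃ w, drinfeldElement ρ * w = 1 := by
  let N : A ⊗[k] A →ₗ[k] A := LinearMap.mul' k A ∘ₗ (TensorProduct.comm k A A).toLinearMap ∘ₗ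
    (antipode k ∘ₗ antipode k).rTensor A
  let V : A ⊗[k] A →ₗ[k] A := LinearMap.mul' k A ∘ₗ (TensorProduct.comm k A A).toLinearMap ∘ₗ
    TensorProduct.map (antipode k) (LinearMap.mulRight k (drinfeldElement ρ) ∘ₗ antipode k)
  have hV (a b : A) : V (a ⊗ₜ b) = antipode k b * drinfeldElement ρ * antipode k a := rfl
  have h₁ (z : A ⊗[k] A) : drinfeldElement ρ * N z = V (map (antipode k) (antipode k) z) := by
    induction z with
    | zero => simp
    | add y z hy hz => simp only [map_add, mul_add, hy, hz]
    | tmul a b =>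
      rw [TensorProduct.map_tmul, hV, antipode_antipode_mul_drinfeldElement hρ, mul_assoc]
      rfl
  have h₂ (z : A ⊗[k] A) : V z = antipodeMul k A (ρ * (antipode k).rTensor A z) := by
    induction z with
    | zero => simp
    | add y z hy hz => simp only [map_add, mul_add, hy, hz]
    | tmul a b => rw [hV, LinearMap.rTensor_tmul, antipodeMul_mul_tmul, drinfeldElement_eq]
  refine ⟨N ρ, ?_⟩
  rw [h₁, hρ.map_antipode_antipode, h₂, hρ.mul_rTensor_antipode, Algebra.TensorProduct.one_def,
    antipodeMul_tmul, antipode_one, mul_one]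

variable {G : GroupLike k A}

theorem isUnit_inv_mul_drinfeldElement (hρ : IsQuasitriangular ρ) (hG : IsSpecialGrouplike ρ G) :
    IsUnit ((G⁻¹).val * drinfeldElement ρ) := by
  obtain ⟨w, hw⟩ := exists_drinfeldElement_mul_eq_one hρ
  have h : (G⁻¹).val * drinfeldElement ρ * (w * G.val) = 1 := by
    rw [mul_assoc, ← mul_assoc _ w, hw, one_mul, ← GroupLike.val_mul, inv_mul_cancel,
      GroupLike.val_one]
  -- Centrality makes the right inverse two-sided.
  exact ⟨⟨_, _, h, (hG.mem_center.comm _).symm.trans h⟩, rfl⟩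

theorem drinfeldElement_eq_mul (ρ : A ⊗[k] A) (G : GroupLike k A) :
    drinfeldElement ρ = G.val * ((G⁻¹).val * drinfeldElement ρ) := by
  rw [← mul_assoc, ← GroupLike.val_mul, mul_inv_cancel, GroupLike.val_one, one_mul]

/-- `S²(x) = G x G⁻¹`. -/
theorem antipode_antipode_eq (hρ : IsQuasitriangular ρ) (hG : IsSpecialGrouplike ρ G) (x : A) :
    antipode k (antipode k x) = G.val * x * (G⁻¹).val := by
  have h : antipode k (antipode k x) * G.val * ((G⁻¹).val * drinfeldElement ρ) =
      G.val * x * ((G⁻¹).val * drinfeldElement ρ) := by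
    rw [mul_assoc, ← drinfeldElement_eq_mul, antipode_antipode_mul_drinfeldElement hρ,
      mul_assoc G.val, ← (hG.mem_center.comm x).eq, ← mul_assoc, ← drinfeldElement_eq_mul]
  have h' := (isUnit_inv_mul_drinfeldElement hρ hG).mul_right_cancel h
  rw [← h', mul_assoc, ← GroupLike.val_mul, mul_inv_cancel, GroupLike.val_one, mul_one]

theorem antipode_surjective (hρ : IsQuasitriangular ρ) (hG : IsSpecialGrouplike ρ G) :
    Function.Surjective (antipode k (A := A)) := fun x =>
  ⟨antipode k ((G⁻¹).val * x * G.val), by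
    rw [antipode_antipode_eq hρ hG, ← mul_assoc, ← mul_assoc, ← GroupLike.val_mul, mul_inv_cancel,
      GroupLike.val_one, one_mul, mul_assoc, ← GroupLike.val_mul, mul_inv_cancel,
      GroupLike.val_one, mul_one]⟩

theorem antipode_injective (hρ : IsQuasitriangular ρ) (hG : IsSpecialGrouplike ρ G) :
    Function.Injective (antipode k (A := A)) := by
  intro x y h
  have h' : G.val * x * (G⁻¹).val = G.val * y * (G⁻¹).val := by
    rw [← antipode_antipode_eq hρ hG, ← antipode_antipode_eq hρ hG, h]
  exact G.2.isUnit.mul_left_cancel ((G⁻¹).2.isUnit.mul_right_cancel h')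

end RMatrix

/-! ### Slice maps. -/

section Slices

variable {k A : Type*} [CommRing k] [Ring A] [HopfAlgebra k A]

/-- The slice map `a ⊗ b ↦ f(a) b`. -/
noncomputable def leftSlice (f : Module.Dual k A) : A ⊗[k] A →ₗ[k] A :=
  (TensorProduct.lid k A).toLinearMap ∘ₗ f.rTensor A

/-- The slice map `a ⊗ b ↦ f(b) a`. -/
noncomputable def rightSlice (f : Module.Dual k A) : A ⊗[k] A →ₗ[k] A :=
  (TensorProduct.rid k A).toLinearMap ∘ₗ f.lTensor A

@[simp] theorem leftSlice_tmul (f : Module.Dual k A) (a b : A) :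
    leftSlice f (a ⊗ₜ b) = f a • b := by simp [leftSlice]

@[simp] theorem rightSlice_tmul (f : Module.Dual k A) (a b : A) :
    rightSlice f (a ⊗ₜ b) = f b • a := by simp [rightSlice]

theorem isRightIntegral_iff {l : Module.Dual k A} :
    IsRightIntegral l ↔ ∀ x, leftSlice l (comul x) = l x • 1 := by
  simp only [← Algebra.algebraMap_eq_smul_one]
  rfl

theorem rightSlice_tmul_one_mul (f : Module.Dual k A) (a : A) (w : A ⊗[k] A) :
    rightSlice f ((a ⊗ₜ 1) * w) = a * rightSlice f w := by
  induction w with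
  | zero => simp
  | add x y hx hy => simp only [mul_add, map_add, hx, hy]
  | tmul p q => simp

theorem leftSlice_one_tmul_mul (f : Module.Dual k A) (a : A) (w : A ⊗[k] A) :
    leftSlice f ((1 ⊗ₜ a) * w) = a * leftSlice f w := by
  induction w with
  | zero => simp
  | add x y hx hy => simp only [mul_add, map_add, hx, hy]
  | tmul p q => simp

theorem leftSlice_mul_one_tmul (f : Module.Dual k A) (a : A) (w : A ⊗[k] A) :
    leftSlice f (w * (1 ⊗ₜ a)) = leftSlice f w * a := by
  induction w with
  | zero => simp
  | add x y hx hy => simp only [add_mul, map_add, hx, hy]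
  | tmul p q => simp

theorem apply_rightSlice (f g : Module.Dual k A) (w : A ⊗[k] A) :
    f (rightSlice g w) = g (leftSlice f w) := by
  induction w with
  | zero => simp
  | add x y hx hy => simp only [map_add, hx, hy]
  | tmul p q => simp [mul_comm]

theorem antipode_antipode_tmul_one_mul_comul (w z : A) :
    (antipode k (antipode k w) ⊗ₜ[k] (1 : A)) * comul z =
      ∑ i ∈ (ℛ k w).index, ((1 : A) ⊗ₜ[k] antipode k ((ℛ k w).right i)) *
        comul (antipode k (antipode k ((ℛ k w).left i)) * z) := by
  rw [← sum_antipode_right_mul_comul, Finset.sum_mul]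
  simp only [Bialgebra.comul_mul, mul_assoc]

end Slices

/-! ### Projection onto integrals, and its trace. -/

section DualBasis

variable {k A ι : Type*} [CommRing k] [Ring A] [HopfAlgebra k A] [Fintype ι]
  {e : ι → A} {φ : ι → Module.Dual k A}

theorem map_eq_sum_dualBasis {M : Type*} [AddCommGroup M] [Module k M]
    (he : ∀ x, ∑ i, φ i x • e i = x) (F : A →ₗ[k] M) (x : A) :
    F x = ∑ i, φ i x • F (e i) := by
  conv_lhs => rw [← he x]
  simp

theorem trace_dualBasis_comm (he : ∀ x, ∑ i, φ i x • e i = x) (α β : A →ₗ[k] A) :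
    ∑ i, φ i (α (β (e i))) = ∑ i, φ i (β (α (e i))) := by
  have h (α β : A →ₗ[k] A) (i : ι) :
      φ i (α (β (e i))) = ∑ j, φ j (β (e i)) * φ i (α (e j)) := by
    simpa using map_eq_sum_dualBasis he (φ i ∘ₗ α) (β (e i))
  simp only [h α β, h β α]
  rw [Finset.sum_comm]
  simp only [mul_comm]

variable (e φ) in
/-- The projection `b ↦ ∑ⱼ (id ⊗ eʲ) Δ(S²(eⱼ) b)` onto the left integrals of `A`, whose
transpose projects onto the right integrals of the dual algebra. -/
noncomputable def integralProj : A →ₗ[k] A :=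
  ∑ j, rightSlice (φ j) ∘ₗ comul ∘ₗ LinearMap.mulLeft k (antipode k (antipode k (e j)))

theorem integralProj_apply (b : A) : integralProj e φ b =
    ∑ j, rightSlice (φ j) (comul (antipode k (antipode k (e j)) * b)) := by
  simp [integralProj]

/-- Summing over the dual basis moves `S(w₂)` inside `f`, where it meets `w₁` and cancels. -/
theorem sum_sum_smul_rightSlice (he : ∀ x, ∑ i, φ i x • e i = x) (f : Module.Dual k A)
    (w : A) (X : A ⊗[k] A) :
    ∑ j, ∑ i ∈ (ℛ k w).index, f ((ℛ k w).left i * e j) •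
        rightSlice (φ j) (((1 : A) ⊗ₜ[k] antipode k ((ℛ k w).right i)) * X) =
      counit (R := k) w • rightSlice f X := by
  induction X with
  | zero => simp
  | add x y hx hy => simp only [mul_add, map_add, smul_add, Finset.sum_add_distrib, hx, hy]
  | tmul p q =>
    have h (a b : A) : ∑ j, (f (a * e j) * φ j b) = f (a * b) := by
      have := map_eq_sum_dualBasis he (f ∘ₗ LinearMap.mulLeft k a) b
      simp only [LinearMap.comp_apply, LinearMap.mulLeft_apply, smul_eq_mul] at this
      rw [this]
      simp only [mul_comm]
    rw [Finset.sum_comm]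
    simp only [Algebra.TensorProduct.tmul_mul_tmul, one_mul, rightSlice_tmul, smul_smul,
      ← Finset.sum_smul, h]
    simp only [← mul_assoc, ← map_sum, ← Finset.sum_mul, sum_mul_antipode_eq_smul]
    simp

/-- `S²(w) t = ε(w) t` for `t` in the range of `integralProj`. -/
theorem antipode_antipode_mul_integralProj (he : ∀ x, ∑ i, φ i x • e i = x) (w b : A) :
    antipode k (antipode k w) * integralProj e φ b =
      counit (R := k) w • integralProj e φ b := by
  let R : A →ₗ[k] A ⊗[k] A :=
    comul ∘ₗ LinearMap.mulRight k b ∘ₗ antipode k ∘ₗ antipode k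
  have hR (y : A) : comul (antipode k (antipode k y) * b) = R y := rfl
  have h (y z : A) : antipode k (antipode k y) * (antipode k (antipode k z) * b) =
      antipode k (antipode k (y * z)) * b := by
    simp only [antipode_mul_antidistrib, mul_assoc]
  simp only [integralProj_apply, Finset.mul_sum, Finset.smul_sum, ← rightSlice_tmul_one_mul,
    antipode_antipode_tmul_one_mul_comul, h, map_sum]
  simp only [hR]
  simp only [map_eq_sum_dualBasis he R (_ * _), Finset.mul_sum, map_sum, mul_smul_comm, map_smul]
  simp only [← sum_sum_smul_rightSlice he]
  conv_rhs => rw [Finset.sum_comm]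
  exact Finset.sum_congr rfl fun j _ => Finset.sum_comm

theorem rTensor_rightSlice_comul (f : Module.Dual k A) (z : A) :
    (rightSlice f ∘ₗ comul).rTensor A (comul z) =
      (leftSlice f ∘ₗ comul).lTensor A (comul z) := by
  have h (w : (A ⊗[k] A) ⊗[k] A) : (rightSlice f).rTensor A w =
      (leftSlice f).lTensor A (TensorProduct.assoc k A A A w) := by
    induction w with
    | zero => simp
    | add x y hx hy => simp only [map_add, hx, hy]
    | tmul p q =>
      induction p with
      | zero => simp
      | add x y hx hy => simp only [add_tmul, map_add, hx, hy]
      | tmul a b => simp [smul_tmul]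
  rw [LinearMap.rTensor_comp, LinearMap.comp_apply, h, coassoc_apply, LinearMap.lTensor_comp,
    LinearMap.comp_apply]

/-- On `p ⊗ q` the dual basis sum produces `p ⊗ ∑ f(q₁) S(q₂)q₃`, and `S(q₂)q₃` cancels. -/
theorem sum_sum_smul_lTensor_leftSlice (he : ∀ x, ∑ i, φ i x • e i = x) (f : Module.Dual k A)
    (X : A ⊗[k] A) :
    ∑ j, ∑ i ∈ (ℛ k (e j)).index, f ((ℛ k (e j)).left i) •
        (((1 : A) ⊗ₜ[k] antipode k ((ℛ k (e j)).right i)) *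
          (leftSlice (φ j) ∘ₗ comul).lTensor A X) =
      rightSlice f X ⊗ₜ 1 := by
  induction X with
  | zero => simp
  | add x y hx hy => simp only [mul_add, map_add, smul_add, Finset.sum_add_distrib, hx, hy,
      add_tmul]
  | tmul p q =>
    let H : A →ₗ[k] A := leftSlice f ∘ₗ (antipode k).lTensor A ∘ₗ comul
    have hH (y : A) :
        H y = ∑ i ∈ (ℛ k y).index, f ((ℛ k y).left i) • antipode k ((ℛ k y).right i) := by
      simp only [H, LinearMap.comp_apply]
      rw [← (ℛ k y).eq]
      simp
    have h := sum_sum_repr_assoc (k := k) (fun a b c : A => f a • (antipode k b * c))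
      (fun b c => ⟨by simp [add_smul], by simp [mul_smul]⟩)
      (fun a c => ⟨by simp [add_mul], fun t b => by simp [smul_smul, mul_comm]⟩)
      (fun a b => ⟨by simp [mul_add], fun t b => by simp [smul_smul, mul_comm]⟩) q
    simp only [← smul_mul_assoc, ← Finset.sum_mul, ← hH] at h
    simp only [smul_mul_assoc, ← Finset.smul_sum, sum_antipode_mul_eq_smul, smul_smul] at h
    simp only [LinearMap.lTensor_tmul, Algebra.TensorProduct.tmul_mul_tmul, one_mul,
      ← tmul_smul, ← tmul_sum, rightSlice_tmul, smul_tmul]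
    congr 1
    simp only [← smul_mul_assoc, ← Finset.sum_mul, ← hH, LinearMap.comp_apply]
    have hq (j : ι) : leftSlice (φ j) (comul q) =
        ∑ i ∈ (ℛ k q).index, φ j ((ℛ k q).left i) • (ℛ k q).right i := by
      rw [← (ℛ k q).eq]; simp
    simp only [hq, Finset.mul_sum]
    rw [Finset.sum_comm]
    simp only [mul_smul_comm, ← smul_mul_assoc, ← Finset.sum_mul, ← map_eq_sum_dualBasis he H]
    rw [h, ← Finset.sum_smul]
    conv_rhs => rw [← sum_counit_smul_right (k := k) q]
    simp [mul_comm]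

/-- This makes `f ∘ P` a right integral for every functional `f`. Coassociativity moves the slice to
the second leg, where the antipode cancels it. -/
theorem rTensor_integralProj_comul (he : ∀ x, ∑ i, φ i x • e i = x) (x : A) :
    (integralProj e φ).rTensor A (comul x) = integralProj e φ x ⊗ₜ 1 := by
  let R : A →ₗ[k] A ⊗[k] A :=
    comul ∘ₗ LinearMap.mulRight k x ∘ₗ antipode k ∘ₗ antipode k
  have hR (y : A) : comul (antipode k (antipode k y) * x) = R y := rfl
  have h₁ (X : A ⊗[k] A) : (integralProj e φ).rTensor A X =
      ∑ j, (rightSlice (φ j) ∘ₗ comul).rTensor A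
        ((antipode k (antipode k (e j)) ⊗ₜ 1) * X) := by
    induction X with
    | zero => simp
    | add x y hx hy => simp only [mul_add, map_add, Finset.sum_add_distrib, hx, hy]
    | tmul p q => simp [integralProj_apply, sum_tmul]
  have h₂ (f : A →ₗ[k] A) (a : A) (X : A ⊗[k] A) :
      f.rTensor A (((1 : A) ⊗ₜ[k] a) * X) = ((1 : A) ⊗ₜ[k] a) * f.rTensor A X := by
    induction X with
    | zero => simp
    | add x y hx hy => simp only [mul_add, map_add, hx, hy]
    | tmul p q => simp
  have h₃ (f : Module.Dual k A) (y : A) : (rightSlice f ∘ₗ comul).rTensor A (R y) =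
      ∑ m, φ m y • (leftSlice f ∘ₗ comul).lTensor A (R (e m)) := by
    rw [← hR, rTensor_rightSlice_comul, hR, map_eq_sum_dualBasis he R]
    simp
  rw [h₁]
  simp only [antipode_antipode_tmul_one_mul_comul, map_sum, h₂, hR, h₃]
  simp only [Finset.mul_sum, mul_smul_comm]
  rw [integralProj_apply, sum_tmul]
  simp only [hR, ← sum_sum_smul_lTensor_leftSlice he]
  conv_rhs => rw [Finset.sum_comm]
  exact Finset.sum_congr rfl fun j _ => Finset.sum_comm

theorem isRightIntegral_comp_integralProj (he : ∀ x, ∑ i, φ i x • e i = x)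
    (f : Module.Dual k A) : IsRightIntegral (f ∘ₗ integralProj e φ) := by
  rw [isRightIntegral_iff]
  intro x
  have h := congr(leftSlice f $(rTensor_integralProj_comul he x))
  rw [leftSlice_tmul] at h
  rw [LinearMap.comp_apply, ← h, leftSlice, leftSlice, LinearMap.rTensor_comp]
  rfl

/-- Integrating out the first leg leaves `∑ⱼ φⱼ(1) l(S²(eⱼ)x) = l(S²(1)x)`. -/
theorem IsRightIntegral.comp_integralProj (he : ∀ x, ∑ i, φ i x • e i = x)
    {l : Module.Dual k A} (hl : IsRightIntegral l) (x : A) : l (integralProj e φ x) = l x := by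
  rw [isRightIntegral_iff] at hl
  have h := map_eq_sum_dualBasis he
    (l ∘ₗ LinearMap.mulRight k x ∘ₗ antipode k ∘ₗ antipode k) 1
  simp only [LinearMap.comp_apply, antipode_one, LinearMap.mulRight_apply, one_mul,
    smul_eq_mul] at h
  rw [h]
  simp only [integralProj_apply, map_sum, apply_rightSlice, hl, map_smul, smul_eq_mul, mul_comm]

theorem integralProj_integralProj (he : ∀ x, ∑ i, φ i x • e i = x) (x : A) :
    integralProj e φ (integralProj e φ x) = integralProj e φ x := by
  rw [← he (integralProj e φ (integralProj e φ x)), ← he (integralProj e φ x)]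
  refine Finset.sum_congr rfl fun i _ => ?_
  congr 1
  rw [he]
  exact (isRightIntegral_comp_integralProj he (φ i)).comp_integralProj he x

/-- Since `S²(eⱼ)S(eᵢ) = S(eᵢS(eⱼ))`, expanding `eᵢS(eⱼ)` in the basis turns the sums over `i`, `j`
into `y₁S(y₂)` with `y = S(eₘ)`. What remains is `∑ₘ φₘ(1) ε(eₘ) = ε(1)`. -/
theorem trace_integralProj_antipode (he : ∀ x, ∑ i, φ i x • e i = x) :
    ∑ i, φ i (integralProj e φ (antipode k (e i))) = 1 := by
  have h₁ (f : Module.Dual k A) (X : A ⊗[k] A) :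
      ∑ i, ∑ j, f (e i * antipode k (e j)) * φ i (rightSlice (φ j) X) =
        f (LinearMap.mul' k A ((antipode k).lTensor A X)) := by
    induction X with
    | zero => simp
    | add x y hx hy => simp only [mul_add, map_add, Finset.sum_add_distrib, hx, hy]
    | tmul p q =>
      have h := map_eq_sum_dualBasis he (f ∘ₗ LinearMap.mulRight k (antipode k q)) p
      have h' (i : ι) := map_eq_sum_dualBasis he
        (f ∘ₗ LinearMap.mulLeft k (e i) ∘ₗ antipode k) q
      simp only [LinearMap.comp_apply, LinearMap.mulRight_apply, LinearMap.mulLeft_apply,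
        smul_eq_mul] at h h'
      simp only [LinearMap.lTensor_tmul, LinearMap.mul'_apply, rightSlice_tmul, map_smul,
        smul_eq_mul, h, h', Finset.mul_sum]
      exact Finset.sum_congr rfl fun i _ => Finset.sum_congr rfl fun j _ => by ring
  let P (i j : ι) : Module.Dual k A := φ i ∘ₗ rightSlice (φ j) ∘ₗ comul ∘ₗ antipode k
  have hP (i j : ι) (y : A) : φ i (rightSlice (φ j) (comul (antipode k y))) = P i j y := rfl
  simp only [integralProj_apply, ← antipode_mul_antidistrib, map_sum, hP]
  simp only [map_eq_sum_dualBasis he (P _ _) (_ * _), smul_eq_mul]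
  calc _ = ∑ m, ∑ i, ∑ j, φ m (e i * antipode k (e j)) * P i j (e m) := by
        conv_rhs => rw [Finset.sum_comm]
        exact Finset.sum_congr rfl fun i _ => Finset.sum_comm
    _ = ∑ m, φ m 1 • counit (e m) := by
        simp only [← hP, h₁, mul_antipode_lTensor_comul_apply, counit_antipode,
          Algebra.algebraMap_eq_smul_one, map_smul, smul_eq_mul, mul_comm]
    _ = 1 := by rw [← map_eq_sum_dualBasis he, Bialgebra.counit_one]

end DualBasis

/-- The values `l(S(t))`, for right integrals `l` of the dual and left integrals `t` of `A`,
generate the unit ideal. -/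
theorem span_integral_apply_antipode_eq_top {k A : Type*} [CommRing k] [Ring A]
    [HopfAlgebra k A] [Module.Finite k A] [Module.Projective k A]
    (hS : Function.Surjective (antipode k (A := A))) :
    Ideal.span {c : k | ∃ (l : Module.Dual k A) (t : A), IsRightIntegral l ∧
      (∀ x : A, x * t = counit (R := k) x • t) ∧ l (antipode k t) = c} = ⊤ := by
  obtain ⟨n, f, g, -, -, hfg⟩ := Module.Finite.exists_comp_eq_id_of_projective k A
  let e (i : Fin n) : A := f (Pi.single i 1)
  let φ (i : Fin n) : Module.Dual k A := LinearMap.proj i ∘ₗ g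
  have he (x : A) : ∑ i, φ i x • e i = x := by
    calc _ = f (g x) := by
          conv_rhs => rw [← Finset.univ_sum_single (g x), map_sum]
          refine Finset.sum_congr rfl fun i _ => ?_
          have h : (Pi.single i (g x i) : Fin n → k) = g x i • Pi.single i 1 := by
            simp [← Pi.single_smul]
          rw [h, map_smul]
          rfl
      _ = x := congr($hfg x)
  rw [Ideal.eq_top_iff_one, ← trace_integralProj_antipode he]
  -- As `P` is idempotent, `P ∘ S` and `P ∘ S ∘ P` have the same trace; in the latter each term
  -- pairs a right integral with `S` of a left integral.
  have h : ∑ i, φ i (integralProj e φ (antipode k (e i))) =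
      ∑ i, φ i (integralProj e φ (antipode k (integralProj e φ (e i)))) := by
    have := trace_dualBasis_comm he (integralProj e φ ∘ₗ antipode k) (integralProj e φ)
    simp only [LinearMap.comp_apply, integralProj_integralProj he] at this
    exact this.symm
  rw [h]
  refine Ideal.sum_mem _ fun i _ => Ideal.subset_span
    ⟨φ i ∘ₗ integralProj e φ, integralProj e φ (e i), isRightIntegral_comp_integralProj he _,
      fun x => ?_, rfl⟩
  -- The range of `P` is only known to absorb elements `S²(w)`, so `x` is written in that form.
  obtain ⟨y, rfl⟩ := hS x
  obtain ⟨w, rfl⟩ := hS y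
  rw [antipode_antipode_mul_integralProj he, counit_antipode, counit_antipode]

/-! ### Pairing integrals of the algebra with integrals of its dual. -/

section Integrals

variable {k A : Type*} [CommRing k] [Ring A] [HopfAlgebra k A] {t : A} {l : Module.Dual k A}

theorem antipode_tmul_one_mul_comul (ht : ∀ x : A, x * t = counit (R := k) x • t) (x : A) :
    (antipode k x ⊗ₜ[k] (1 : A)) * comul t = ((1 : A) ⊗ₜ x) * comul t := by
  rw [← sum_antipode_left_mul_comul x, Finset.sum_mul]
  simp only [mul_assoc, ← Bialgebra.comul_mul, ht, map_smul, mul_smul_comm]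
  simp only [← smul_mul_assoc, smul_tmul', ← map_smul, ← Finset.sum_mul, ← sum_tmul, ← map_sum,
    sum_counit_smul_right]

theorem comul_mul_tmul_one (ht : ∀ x : A, t * x = counit (R := k) x • t) (y : A) :
    comul t * (y ⊗ₜ[k] (1 : A)) = comul t * ((1 : A) ⊗ₜ antipode k y) := by
  rw [← sum_comul_mul_antipode_right y, Finset.mul_sum]
  simp only [← mul_assoc, ← Bialgebra.comul_mul, ht, map_smul, smul_mul_assoc]
  simp only [← mul_smul_comm, ← tmul_smul, ← map_smul, ← Finset.mul_sum, ← tmul_sum, ← map_sum,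
    sum_counit_smul]

/-- With `w = ρ`, the factor on the right becomes `∑ e S(e') = S(u)`. -/
theorem mul_comul_eq (ht : ∀ x : A, x * t = counit (R := k) x • t) (w : A ⊗[k] A) :
    w * comul t = (LinearMap.mul' k A ((antipode k).lTensor A w) ⊗ₜ 1) * comul t := by
  induction w with
  | zero => simp
  | add x y hx hy => simp only [add_mul, map_add, add_tmul, hx, hy]
  | tmul a b =>
    have h : a ⊗ₜ[k] b = (a ⊗ₜ 1) * (1 ⊗ₜ b) := by simp
    rw [h, mul_assoc, ← antipode_tmul_one_mul_comul ht, ← mul_assoc]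
    simp

theorem comm_comul_mul_eq (ht : ∀ x : A, t * x = counit (R := k) x • t) (w : A ⊗[k] A) :
    TensorProduct.comm k A A (comul t) * w =
      TensorProduct.comm k A A (comul t * (1 ⊗ₜ antipodeMul k A w)) := by
  have hc (X Y : A ⊗[k] A) : TensorProduct.comm k A A (X * Y) =
      TensorProduct.comm k A A X * TensorProduct.comm k A A Y :=
    map_mul (Algebra.TensorProduct.comm k A A) X Y
  induction w with
  | zero => simp
  | add x y hx hy => simp only [mul_add, map_add, tmul_add, hx, hy]
  | tmul a b =>
    have h : (1 : A) ⊗ₜ[k] antipodeMul k A (a ⊗ₜ b) = (1 ⊗ₜ antipode k b) * (1 ⊗ₜ a) := by simp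
    rw [h, ← mul_assoc, ← comul_mul_tmul_one ht, mul_assoc, hc]
    simp

theorem leftSlice_mul_tmul_one (f : Module.Dual k A) (y : A) (X : A ⊗[k] A) :
    leftSlice f (X * (y ⊗ₜ 1)) = leftSlice (f ∘ₗ LinearMap.mulRight k y) X := by
  induction X with
  | zero => simp
  | add x y hx hy => simp only [add_mul, map_add, hx, hy]
  | tmul p q => simp

theorem leftSlice_tmul_one_mul (f : Module.Dual k A) (y : A) (X : A ⊗[k] A) :
    leftSlice f ((y ⊗ₜ 1) * X) = leftSlice (f ∘ₗ LinearMap.mulLeft k y) X := by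
  induction X with
  | zero => simp
  | add x y hx hy => simp only [mul_add, map_add, hx, hy]
  | tmul p q => simp

theorem rightSlice_comm (f : Module.Dual k A) (X : A ⊗[k] A) :
    rightSlice f (TensorProduct.comm k A A X) = leftSlice f X := by
  induction X with
  | zero => simp
  | add x y hx hy => simp only [map_add, hx, hy]
  | tmul p q => simp

theorem leftSlice_sub (f g : Module.Dual k A) (X : A ⊗[k] A) :
    leftSlice (f - g) X = leftSlice f X - leftSlice g X := by
  simp [leftSlice, LinearMap.rTensor_sub]

/-- `∑ l(t₁ y) t₂ = l(t) S(y)`. -/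
theorem IsRightIntegral.leftSlice_comp_mulRight (hl : IsRightIntegral l)
    (ht : ∀ x : A, t * x = counit (R := k) x • t) (y : A) :
    leftSlice (l ∘ₗ LinearMap.mulRight k y) (comul t) = l t • antipode k y := by
  rw [← leftSlice_mul_tmul_one, comul_mul_tmul_one ht, leftSlice_mul_one_tmul,
    isRightIntegral_iff.1 hl, smul_mul_assoc, one_mul]

/-- `∑ l(S(x) t₁) t₂ = l(t) x`. -/
theorem IsRightIntegral.leftSlice_comp_mulLeft (hl : IsRightIntegral l)
    (ht : ∀ x : A, x * t = counit (R := k) x • t) (x : A) :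
    leftSlice (l ∘ₗ LinearMap.mulLeft k (antipode k x)) (comul t) = l t • x := by
  rw [← leftSlice_tmul_one_mul, antipode_tmul_one_mul_comul ht, leftSlice_one_tmul_mul,
    isRightIntegral_iff.1 hl, mul_smul_comm, mul_one]

theorem leftSlice_comul_antipode (f : Module.Dual k A) (x : A) :
    leftSlice f (comul (antipode k x)) =
      antipode k (rightSlice (f ∘ₗ antipode k) (comul x)) := by
  rw [comul_antipode, ← (ℛ k x).eq]
  simp

theorem rightSlice_comul_antipode (f : Module.Dual k A) (x : A) :
    rightSlice f (comul (antipode k x)) =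
      antipode k (leftSlice (f ∘ₗ antipode k) (comul x)) := by
  rw [comul_antipode, ← (ℛ k x).eq]
  simp

/-- The composite of a right integral with the antipode is a left integral. -/
theorem IsRightIntegral.rightSlice_comp_antipode (hl : IsRightIntegral l)
    (hS : Function.Injective (antipode k (A := A))) (x : A) :
    rightSlice (l ∘ₗ antipode k) (comul x) = l (antipode k x) • 1 := by
  apply hS
  rw [← leftSlice_comul_antipode, isRightIntegral_iff.1 hl, map_smul, antipode_one]

/-- Evaluate `f ⊗ (l ∘ S)` on `(1 ⊗ x)Δ(t) = (S(x) ⊗ 1)Δ(t)`, using that `l ∘ S` is a left integral.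
It recovers `f` from its slice of `Δ(t)`, up to the scalar `l(S(t))`. -/
theorem IsRightIntegral.apply_antipode_mul_apply (hl : IsRightIntegral l)
    (hS : Function.Injective (antipode k (A := A)))
    (ht : ∀ x : A, x * t = counit (R := k) x • t) (f : Module.Dual k A) (x : A) :
    l (antipode k t) * f (antipode k x) = l (antipode k (x * leftSlice f (comul t))) := by
  have h := apply_rightSlice f (l ∘ₗ antipode k) ((1 ⊗ₜ x) * comul t)
  rw [leftSlice_one_tmul_mul, ← antipode_tmul_one_mul_comul ht, rightSlice_tmul_one_mul,
    hl.rightSlice_comp_antipode hS, mul_smul_comm, mul_one, map_smul, smul_eq_mul] at h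
  exact h

theorem antipode_mul_of_left_integral (hS : Function.Surjective (antipode k (A := A)))
    (ht : ∀ x : A, x * t = counit (R := k) x • t) (x : A) :
    antipode k t * x = counit (R := k) x • antipode k t := by
  obtain ⟨y, rfl⟩ := hS x
  rw [← antipode_mul_antidistrib, ht, map_smul, counit_antipode]

/-- Take `x = t` in `∑ l(S(x)t₁)t₂ = l(t)x`; since `S(t)` is a right integral, the left side is
`l(S(t)) ∑ ε(t₁)t₂`. -/
theorem IsRightIntegral.apply_antipode_smul (hl : IsRightIntegral l)
    (hS : Function.Surjective (antipode k (A := A)))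
    (ht : ∀ x : A, x * t = counit (R := k) x • t) : l (antipode k t) • t = l t • t := by
  rw [← hl.leftSlice_comp_mulLeft ht]
  have h : l ∘ₗ LinearMap.mulLeft k (antipode k t) =
      l (antipode k t) • (counit : A →ₗ[k] k) := by
    ext x
    simp [antipode_mul_of_left_integral hS ht, mul_comm]
  rw [h, leftSlice, LinearMap.rTensor_smul]
  simp

end Integrals

theorem eq_zero_of_forall_mul_eq_zero {k : Type*} [CommRing k] {s : Set k}
    (hs : Ideal.span s = ⊤) {c : k} (hc : ∀ a ∈ s, a * c = 0) : c = 0 := by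
  have h : Ideal.span s ≤ LinearMap.ker (LinearMap.toSpanSingleton k k c) :=
    Ideal.span_le.2 fun a ha => by simpa using hc a ha
  simpa using h (hs ▸ Submodule.mem_top : (1 : k) ∈ Ideal.span s)

/-! ### The two identities for right integrals. -/

section Unimodular

variable {k A : Type*} [CommRing k] [Ring A] [HopfAlgebra k A]
  {ρ : A ⊗[k] A} {G : GroupLike k A} {l : Module.Dual k A}

/-- `∑ t₁ l(t₂) = l(t) G²` for a two-sided integral `t`. -/
theorem IsRightIntegral.rightSlice_comul (hl : IsRightIntegral l) (hρ : IsQuasitriangular ρ)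
    (hG : IsSpecialGrouplike ρ G) {t : A} (ht : ∀ x : A, x * t = counit (R := k) x • t)
    (ht' : ∀ x : A, t * x = counit (R := k) x • t) :
    rightSlice l (comul t) = l t • (G * G).val := by
  -- The slice reads `S(u) · ∑ t₁l(t₂) = l(t) u`. Putting `v = G⁻¹u`, this is `vG⁻¹ · ∑ t₁l(t₂) =
  -- l(t) vG`, and the central unit `v` cancels.
  have h := congr(rightSlice l $(hρ.mul_comul t))
  rw [mul_comul_eq ht, ← antipode_drinfeldElement hρ, rightSlice_tmul_one_mul,
    comm_comul_mul_eq ht', rightSlice_comm, leftSlice_mul_one_tmul, isRightIntegral_iff.1 hl,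
    hG.antipode_drinfeldElement, ← drinfeldElement_eq] at h
  have hu : (G⁻¹).val * drinfeldElement ρ * G.val = drinfeldElement ρ := by
    rw [(hG.mem_center.comm _).eq, ← drinfeldElement_eq_mul]
  have h' : (G⁻¹).val * rightSlice l (comul t) = l t • G.val := by
    refine (isUnit_inv_mul_drinfeldElement hρ hG).mul_left_cancel ?_
    rw [← mul_assoc, h, smul_mul_assoc, one_mul, mul_smul_comm, hu]
  rw [GroupLike.val_mul, ← mul_smul_comm, ← h', ← mul_assoc, ← GroupLike.val_mul,
    mul_inv_cancel, GroupLike.val_one, one_mul]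

variable [Module.Finite k A] [Module.Projective k A]

/-- `l(x y) = l(S²(y) x)`. -/
theorem IsRightIntegral.apply_mul (hl : IsRightIntegral l) (hA : IsUnimodular k A)
    (hS : Function.Bijective (antipode k (A := A))) (x y : A) :
    l (x * y) = l (antipode k (antipode k y) * x) := by
  obtain ⟨x, rfl⟩ := hS.surjective x
  let f : Module.Dual k A := l ∘ₗ LinearMap.mulRight k y -
    l ∘ₗ LinearMap.mulLeft k (antipode k (antipode k y))
  have hf (t : A) (ht : ∀ x : A, x * t = counit (R := k) x • t) :
      leftSlice f (comul t) = 0 := by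
    rw [leftSlice_sub, hl.leftSlice_comp_mulRight ((hA t).1 ht), hl.leftSlice_comp_mulLeft ht,
      sub_self]
  refine sub_eq_zero.1 (eq_zero_of_forall_mul_eq_zero
    (span_integral_apply_antipode_eq_top hS.surjective) (c := f (antipode k x)) ?_)
  rintro _ ⟨m, t, hm, ht, rfl⟩
  rw [hm.apply_antipode_mul_apply hS.injective ht, hf t ht, mul_zero, map_zero, map_zero]

/-- `l(S(x)) = l(G² x)`. -/
theorem IsRightIntegral.apply_antipode (hl : IsRightIntegral l) (hA : IsUnimodular k A)
    (hρ : IsQuasitriangular ρ) (hG : IsSpecialGrouplike ρ G) (x : A) :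
    l (antipode k x) = l ((G * G).val * x) := by
  have hS : Function.Bijective (antipode k (A := A)) :=
    ⟨antipode_injective hρ hG, antipode_surjective hρ hG⟩
  obtain ⟨x, rfl⟩ := hS.surjective x
  let f : Module.Dual k A := l ∘ₗ antipode k - l ∘ₗ LinearMap.mulLeft k (G * G).val
  have hf (t : A) (ht : ∀ x : A, x * t = counit (R := k) x • t) :
      leftSlice f (comul t) = (l (antipode k t) - l t) • antipode k (G * G).val := by
    have hGG : antipode k (antipode k (G * G).val) = (G * G).val := (G * G).2.antipode_antipode
    have h₁ : leftSlice (l ∘ₗ antipode k) (comul t) =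
        l (antipode k t) • antipode k (G * G).val := by
      apply hS.injective
      have ht' := antipode_mul_of_left_integral hS.surjective ht
      rw [← rightSlice_comul_antipode, hl.rightSlice_comul hρ hG ((hA _).2 ht') ht', map_smul,
        hGG]
    -- The slice formula needs a left factor of the form `S(y)`; `S` fixes `G²` after two
    -- applications, so `y = S(G²)`.
    have h₂ := hl.leftSlice_comp_mulLeft ht (antipode k (G * G).val)
    rw [hGG] at h₂
    rw [leftSlice_sub, h₁, h₂, sub_smul]
  -- One factor `m(S(t))` recovers `f(S(x))` from its slice, a multiple of `l(S(t)) - l(t)`; the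
  -- second kills that scalar. Hence squares of the generators.
  refine sub_eq_zero.1 (eq_zero_of_forall_mul_eq_zero (Ideal.span_pow_eq_top _
    (span_integral_apply_antipode_eq_top hS.surjective) 2) (c := f (antipode k x)) ?_)
  rintro _ ⟨_, ⟨m, t, hm, ht, rfl⟩, rfl⟩
  have h : m (antipode k t) * (l (antipode k t) - l t) = 0 := by
    rw [mul_comm, ← smul_eq_mul, ← map_smul, ← map_smul, sub_smul,
      hl.apply_antipode_smul hS.surjective ht, sub_self, map_zero, map_zero]
  dsimp only
  rw [pow_two, mul_assoc, hm.apply_antipode_mul_apply hS.injective ht, hf t ht,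
    mul_smul_comm, map_smul, map_smul, smul_eq_mul, ← mul_assoc, h, zero_mul]

end Unimodular

end RibbonHopf

theorem mainTheorem2 {k A : Type*} [CommRing k] [Ring A] [HopfAlgebra k A]
    [Module.Finite k A] [Module.Projective k A]
    (hA : RibbonHopf.IsUnimodular k A)
    (ρ : A ⊗[k] A) (hρ : RibbonHopf.IsQuasitriangular ρ)
    (G : GroupLike k A) (hG : RibbonHopf.IsSpecialGrouplike ρ G)
    (l : Module.Dual k A) (hl : RibbonHopf.IsRightIntegral l) :
    (∀ x y : A, RibbonHopf.tr l G (x * y) = RibbonHopf.tr l G (y * x)) ∧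
      (∀ x : A, RibbonHopf.tr l G (HopfAlgebra.antipode k x) = RibbonHopf.tr l G x) := by
  have hS : Function.Bijective (HopfAlgebra.antipode k (A := A)) :=
    ⟨RibbonHopf.antipode_injective hρ hG, RibbonHopf.antipode_surjective hρ hG⟩
  have htr (x : A) : RibbonHopf.tr l G x = l (G.val * x) := rfl
  have hGG : (G⁻¹).val * G.val = 1 := by
    rw [← GroupLike.val_mul, inv_mul_cancel, GroupLike.val_one]
  have hcomm (x y : A) : RibbonHopf.tr l G (x * y) = RibbonHopf.tr l G (y * x) := by
    rw [htr, htr, ← mul_assoc, hl.apply_mul hA hS, RibbonHopf.antipode_antipode_eq hρ hG,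
      ← mul_assoc, mul_assoc _ (G⁻¹).val, hGG, mul_one, mul_assoc]
  refine ⟨hcomm, fun x => ?_⟩
  have h : G.val * HopfAlgebra.antipode k x = HopfAlgebra.antipode k (x * (G⁻¹).val) := by
    rw [HopfAlgebra.antipode_mul_antidistrib, GroupLike.val_inv, G.2.antipode_antipode]
  rw [htr, h, hl.apply_antipode hA hρ hG, GroupLike.val_mul, mul_assoc, ← htr, ← mul_assoc,
    hcomm, ← mul_assoc, hGG, one_mul]
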